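/- Let $G$ be a countable (simple, not necessarily connected) graph, with its graph metric, in which vertices of different components are at infinite distance. For a finite set $F\subset V(G)$ let $\partial(F)$ be the set of vertices in $F$ that are adjacent to a vertex that is not in $F$. A nonempty finite set $F\subset V(G)$ is called $\varepsilon$-Følner if $\frac{|\partial(F)|}{|F|}<\varepsilon$. The graph $G$ is uniformly amenable if for any $\varepsilon>0$ there exists an $r$ such that for every vertex $x$ the ball $B^G_r(x)$ of radius $r$ around $x$ contains an $\varepsilon$-Følner set of $G$. The graph $G$ is almost finite if for any $\varepsilon>0$ there exists an $r>1$ such that $V(G)$ can be partitioned into $\varepsilon$-Følner sets of diameter at most $r$ in the metric of $G$. Then there exist a natural number $d$ and a countable graph $G$ all of whose vertices have degree at most $d$ such that $G$ is uniformly amenable but not almost finite. -/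

import Mathlib

namespace FolnerGraph

variable {V : Type*}

/-- The graph `G` belongs to the class of graphs of vertex degree bound `d`. -/
def HasDegreeBound (G : SimpleGraph V) (d : ℕ) : Prop :=
  ∀ v : V, (G.neighborSet v).encard ≤ d

/-- The (inner vertex) boundary of `F`: the vertices in `F` that are adjacent to a vertex
that is not in `F`. -/
def boundary (G : SimpleGraph V) (F : Set V) : Set V :=
  {x | x ∈ F ∧ ∃ y, y ∉ F ∧ G.Adj x y}

/-- A (finite, nonempty) `ε`-Følner set of `G`. -/
structure IsFolner (G : SimpleGraph V) (ε : ℝ) (F : Set V) : Prop where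
  finite : F.Finite
  nonempty : F.Nonempty
  ratio_lt : ((boundary G F).ncard : ℝ) / (F.ncard : ℝ) < ε

/-- The (closed) ball of radius `r` around `x` in the graph metric of `G`; vertices in different
components are at infinite distance. -/
def closedBall (G : SimpleGraph V) (x : V) (r : ℕ) : Set V :=
  {y | G.edist x y ≤ (r : ℕ∞)}

/-- The diameter of `F`, measured in the graph metric of `G`, is at most `r`. -/
def DiamLE (G : SimpleGraph V) (F : Set V) (r : ℕ) : Prop :=
  ∀ x ∈ F, ∀ y ∈ F, G.edist x y ≤ (r : ℕ∞)

/-- For any `ε > 0` there is an `r` such that every `r`-ball contains an `ε`-Følner set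
of `G`. -/
def UniformlyAmenable (G : SimpleGraph V) : Prop :=
  ∀ ε : ℝ, 0 < ε → ∃ r : ℕ, ∀ x : V, ∃ F : Set V, F ⊆ closedBall G x r ∧ IsFolner G ε F

/-- An `(ε, r)`-packing: a family of pairwise disjoint `ε`-Følner sets of diameter at
most `r`. -/
structure IsFolnerPacking (G : SimpleGraph V) (ε : ℝ) (r : ℕ) (P : Set (Set V)) : Prop where
  disjoint : P.PairwiseDisjoint id
  folner : ∀ F ∈ P, IsFolner G ε F
  diam_le : ∀ F ∈ P, DiamLE G F r

/-- For any `ε > 0` there is an `r > 1` such that the vertex set of `G` is tiled by `ε`-Følner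
sets of diameter at most `r`. -/
def AlmostFinite (G : SimpleGraph V) : Prop :=
  ∀ ε : ℝ, 0 < ε → ∃ r : ℕ, 1 < r ∧ ∃ P : Set (Set V),
    IsFolnerPacking G ε r P ∧ ⋃₀ P = Set.univ

end FolnerGraph

/-! ### Doubling in `SL(2, ℤ)` by ping-pong on first columns. -/

section SpecialLinear

open Matrix ModularGroup CongruenceSubgroup
open scoped MatrixGroups Pointwise

/-! The graph is the disjoint union over `k` of the Cayley graphs of `SL(2, ℤ) ⧸ Γ(3 ^ k)`, with a
tail glued to each coset, of height at least `n` exactly when the coset meets `Γ(3 ^ n)`.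

Long tail segments are Følner. Cosets with tails of height `n` are dense at a scale depending on `n`
but not on `k`, because `Γ(3 ^ n)` has finite index. This gives uniform amenability.

Tails are nevertheless too sparse for a tiling. For `k` large, tiles of diameter at most `r` see
only an injective copy of a ball of `SL(2, ℤ)`, where doubling (`two_mul_ncard_le`) bounds the base
part of a tile by twice its boundary. A `1/4`-Følner tile then has less than half its points in the
base. Since `Γ(3 ^ n)` has index at least `2 ^ n`, base and tails up to height `r` have at most
twice as many points as the base, a contradiction (`tailedGraph_not_almostFinite`). -/

/-- The upper unipotent matrix with off-diagonal entry `n`. -/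
def upperUnipotent (n : ℤ) : SL(2, ℤ) := ⟨!![1, n; 0, 1], by simp⟩

/-- The lower unipotent matrix with off-diagonal entry `n`. -/
def lowerUnipotent (n : ℤ) : SL(2, ℤ) := ⟨!![1, 0; n, 1], by simp⟩

lemma coe_upperUnipotent (n : ℤ) :
    (upperUnipotent n : Matrix (Fin 2) (Fin 2) ℤ) = !![1, n; 0, 1] := rfl

lemma coe_lowerUnipotent (n : ℤ) :
    (lowerUnipotent n : Matrix (Fin 2) (Fin 2) ℤ) = !![1, 0; n, 1] := rfl

lemma upperUnipotent_mul_fst (n : ℤ) (w : SL(2, ℤ)) :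
    (upperUnipotent n * w) 0 0 = w 0 0 + n * w 1 0 := by
  simp [Matrix.SpecialLinearGroup.coe_mul, coe_upperUnipotent, Matrix.mul_apply, Fin.sum_univ_two]

lemma upperUnipotent_mul_snd (n : ℤ) (w : SL(2, ℤ)) :
    (upperUnipotent n * w) 1 0 = w 1 0 := by
  simp [Matrix.SpecialLinearGroup.coe_mul, coe_upperUnipotent, Matrix.mul_apply, Fin.sum_univ_two]

lemma lowerUnipotent_mul_fst (n : ℤ) (w : SL(2, ℤ)) :
    (lowerUnipotent n * w) 0 0 = w 0 0 := by
  simp [Matrix.SpecialLinearGroup.coe_mul, coe_lowerUnipotent, Matrix.mul_apply, Fin.sum_univ_two]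

lemma lowerUnipotent_mul_snd (n : ℤ) (w : SL(2, ℤ)) :
    (lowerUnipotent n * w) 1 0 = w 1 0 + n * w 0 0 := by
  simp [Matrix.SpecialLinearGroup.coe_mul, coe_lowerUnipotent, Matrix.mul_apply, Fin.sum_univ_two, add_comm]

lemma first_column_ne_zero (w : SL(2, ℤ)) : w 0 0 ≠ 0 ∨ w 1 0 ≠ 0 := by
  by_contra! h
  have := w.det_coe
  rw [Matrix.det_fin_two, h.1, h.2] at this
  simp at this

/-- One of two translates of `w` whose first column is dominated by the coordinate
that does not dominate the first column of `w`. -/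
def pingPong (e : Bool) (w : SL(2, ℤ)) : SL(2, ℤ) :=
  if |w 0 0| ≤ |w 1 0| then upperUnipotent (if e then 3 else -3) * w
  else lowerUnipotent (if e then 3 else -3) * w

/-- If `|x| ≤ |y|` then `|x ± 3y| ≥ 2|y| > |y|`, and symmetrically in the other branch. The
dominating entry of the image thus reveals the branch, its sign relative to the other entry reveals
`e`, and cancellation then gives `w`. -/
lemma pingPong_injective : Function.Injective fun p : Bool × SL(2, ℤ) => pingPong p.1 p.2 := by
  rintro ⟨e, w⟩ ⟨e', w'⟩ h
  have hw := first_column_ne_zero w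
  have hw' := first_column_ne_zero w'
  have h0 : (pingPong e w) 0 0 = (pingPong e' w') 0 0 := congrArg (fun g : SL(2, ℤ) => g 0 0) h
  have h1 : (pingPong e w) 1 0 = (pingPong e' w') 1 0 := congrArg (fun g : SL(2, ℤ) => g 1 0) h
  simp only [pingPong] at h
  by_cases c : |w 0 0| ≤ |w 1 0| <;> by_cases c' : |w' 0 0| ≤ |w' 1 0| <;>
    simp only [pingPong, c, c', if_true, if_false, upperUnipotent_mul_fst, upperUnipotent_mul_snd,
      lowerUnipotent_mul_fst, lowerUnipotent_mul_snd] at h h0 h1 <;>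
    generalize w 0 0 = x at * <;> generalize w 1 0 = y at * <;>
    generalize w' 0 0 = x' at * <;> generalize w' 1 0 = y' at *
  all_goals cases e <;> cases e' <;>
    simp only [if_true, if_false, Bool.false_eq_true] at h h0 h1
  all_goals first
    | rw [mul_left_cancel h]
    | (exfalso; clear h; grind)

/-- A set of generators of `SL(2, ℤ)` containing the matrices used in `pingPong`. -/
def baseGenerators : Set SL(2, ℤ) :=
  {S, T, upperUnipotent 3, upperUnipotent (-3), lowerUnipotent 3, lowerUnipotent (-3)}

/-- A finite symmetric generating set of `SL(2, ℤ)`. -/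
def symmGenerators : Set SL(2, ℤ) :=
  insert 1 (baseGenerators ∪ baseGenerators⁻¹)

lemma symmGenerators_finite : symmGenerators.Finite := by
  have : baseGenerators.Finite := by unfold baseGenerators; exact Set.toFinite _
  exact (this.union this.inv).insert 1

/-- Having the identity among the generators makes the powers `B ^ n` increase with `n`. -/
lemma one_mem_symmGenerators : 1 ∈ symmGenerators := Set.mem_insert _ _

lemma symmGenerators_inv : symmGenerators⁻¹ = symmGenerators := by
  ext g
  simp only [symmGenerators, Set.mem_inv, Set.mem_insert_iff, Set.mem_union, inv_inv, inv_eq_one]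
  tauto

lemma closure_symmGenerators : Subgroup.closure symmGenerators = ⊤ := by
  rw [eq_top_iff, ← SpecialLinearGroup.SL2Z_generators]
  refine Subgroup.closure_mono ?_
  rintro g (rfl | rfl) <;> simp [symmGenerators, baseGenerators]

lemma pingPong_mem (e : Bool) (w : SL(2, ℤ)) : ∃ s ∈ symmGenerators, pingPong e w = s * w := by
  unfold pingPong
  split_ifs <;> exact ⟨_, by simp [symmGenerators, baseGenerators], rfl⟩

lemma two_mul_ncard_le {I F : Set SL(2, ℤ)} (hF : F.Finite)
    (h : ∀ w ∈ I, ∀ s ∈ symmGenerators, s * w ∈ F) : 2 * I.ncard ≤ F.ncard := by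
  have h1 : (fun p : Bool × SL(2, ℤ) => pingPong p.1 p.2) '' (Set.univ ×ˢ I) ⊆ F := by
    rintro _ ⟨⟨e, w⟩, hw, rfl⟩
    obtain ⟨s, hs, h2⟩ := pingPong_mem e w
    simp only [h2]
    exact h w hw.2 s hs
  have h2 := Set.ncard_le_ncard h1 hF
  rwa [Set.ncard_image_of_injective _ pingPong_injective, Set.ncard_prod, Set.ncard_univ,
    Nat.card_eq_fintype_card, Fintype.card_bool] at h2

/-! ### The tower of congruence subgroups `Γ(3 ^ n)`. -/

lemma Gamma_three_pow_zero : Gamma (3 ^ 0) = ⊤ := by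
  simpa using Gamma_one_top

lemma Gamma_three_pow_succ_le (n : ℕ) : Gamma (3 ^ (n + 1)) ≤ Gamma (3 ^ n) := by
  intro g hg
  have hd : 3 ^ n ∣ 3 ^ (n + 1) := pow_dvd_pow 3 n.le_succ
  rw [Gamma_mem] at hg ⊢
  refine ⟨?_, ?_, ?_, ?_⟩
  · simpa only [map_intCast, map_one, map_zero] using
      congrArg (ZMod.castHom hd (ZMod (3 ^ n))) hg.1
  · simpa only [map_intCast, map_one, map_zero] using
      congrArg (ZMod.castHom hd (ZMod (3 ^ n))) hg.2.1
  · simpa only [map_intCast, map_one, map_zero] using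
      congrArg (ZMod.castHom hd (ZMod (3 ^ n))) hg.2.2.1
  · simpa only [map_intCast, map_one, map_zero] using
      congrArg (ZMod.castHom hd (ZMod (3 ^ n))) hg.2.2.2

lemma Gamma_three_pow_antitone : Antitone fun n : ℕ => Gamma (3 ^ n) :=
  antitone_nat_of_succ_le Gamma_three_pow_succ_le

/-- Each inclusion in the tower is proper, as `upperUnipotent (3 ^ n)` shows, so each relative index
is at least 2. -/
lemma two_pow_le_index_Gamma (n : ℕ) : 2 ^ n ≤ (Gamma (3 ^ n)).index := by
  induction n with
  | zero => simp [Gamma_one_top]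
  | succ n ih =>
    rw [← Subgroup.relIndex_mul_index (Gamma_three_pow_succ_le n), pow_succ, mul_comm]
    refine Nat.mul_le_mul ?_ ih
    have h0 : (Gamma (3 ^ (n + 1))).relIndex (Gamma (3 ^ n)) ≠ 0 :=
      Subgroup.FiniteIndex.index_ne_zero
    have h1 : (Gamma (3 ^ (n + 1))).relIndex (Gamma (3 ^ n)) ≠ 1 := by
      rw [Ne, Subgroup.relIndex_eq_one]
      intro h
      have h2 : upperUnipotent (3 ^ n) ∈ Gamma (3 ^ n) := by
        rw [Gamma_mem]
        have : (3 : ZMod (3 ^ n)) ^ n = 0 := by exact_mod_cast ZMod.natCast_self (3 ^ n)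
        simp [coe_upperUnipotent, this]
      have h3 := (Gamma_mem.1 (h h2)).2.1
      have h4 : ((3 ^ n : ℕ) : ZMod (3 ^ (n + 1))) = 0 := by simpa [coe_upperUnipotent] using h3
      rw [ZMod.natCast_eq_zero_iff] at h4
      have := (Nat.pow_dvd_pow_iff_le_right (by norm_num : 1 < 3)).1 h4
      omega
    omega

lemma eq_zero_of_forall_cast_three_pow {a : ℤ} (h : ∀ n : ℕ, (a : ZMod (3 ^ n)) = 0) : a = 0 := by
  have h1 := (ZMod.intCast_zmod_eq_zero_iff_dvd a (3 ^ a.natAbs)).1 (h _)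
  refine Int.eq_zero_of_abs_lt_dvd h1 ?_
  rw [Int.abs_eq_natAbs]
  exact_mod_cast Nat.lt_pow_self (by norm_num)

lemma exists_notMem_Gamma {g : SL(2, ℤ)} (hg : g ≠ 1) : ∃ n : ℕ, g ∉ Gamma (3 ^ n) := by
  by_contra! h
  apply hg
  have h' := fun n => Gamma_mem.1 (h n)
  ext i j
  fin_cases i <;> fin_cases j
  · exact sub_eq_zero.1 (eq_zero_of_forall_cast_three_pow fun n => by simp [(h' n).1])
  · exact eq_zero_of_forall_cast_three_pow fun n => (h' n).2.1
  · exact eq_zero_of_forall_cast_three_pow fun n => (h' n).2.2.1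
  · exact sub_eq_zero.1 (eq_zero_of_forall_cast_three_pow fun n => by simp [(h' n).2.2.2])

end SpecialLinear

/-! ### Schreier graphs with tails, and their uniform amenability. -/

namespace FolnerGraph

open scoped Pointwise

section TailedGraph

variable {W : Type*} [Group W] {X : Type*} [MulAction W X]

/-- The graph obtained from the Schreier graph of the action of `W` on `X` with respect to `B` by
attaching to each `x : X` a tail consisting of the points `(x, n)` with `n > 0` and `T x n`. -/
def tailedGraph (B : Set W) (T : X → ℕ → Prop) : SimpleGraph {p : X × ℕ // T p.1 p.2} :=
  SimpleGraph.fromRel fun p q =>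
    (p.1.2 = 0 ∧ q.1.2 = 0 ∧ ∃ s ∈ B, q.1.1 = s • p.1.1) ∨ (p.1.1 = q.1.1 ∧ q.1.2 = p.1.2 + 1)

variable {B : Set W} {T : X → ℕ → Prop}

lemma tailedGraph_adj (hB : B⁻¹ = B) {p q : {p : X × ℕ // T p.1 p.2}} :
    (tailedGraph B T).Adj p q ↔ p ≠ q ∧
      ((p.1.2 = 0 ∧ q.1.2 = 0 ∧ ∃ s ∈ B, q.1.1 = s • p.1.1) ∨
        (p.1.1 = q.1.1 ∧ (q.1.2 = p.1.2 + 1 ∨ p.1.2 = q.1.2 + 1))) := by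
  have key : (∃ s ∈ B, p.1.1 = s • q.1.1) → ∃ s ∈ B, q.1.1 = s • p.1.1 := by
    rintro ⟨s, hs, h⟩
    exact ⟨s⁻¹, by rwa [← Set.mem_inv, hB], by rw [h, inv_smul_smul]⟩
  rw [tailedGraph, SimpleGraph.fromRel_adj, eq_comm (a := q.1.1) (b := p.1.1)]
  refine and_congr_right fun _ => ⟨?_, ?_⟩
  · rintro ((h | ⟨h, h'⟩) | ⟨h, h', h''⟩ | ⟨h, h'⟩)
    exacts [Or.inl h, Or.inr ⟨h, Or.inl h'⟩, Or.inl ⟨h', h, key h''⟩, Or.inr ⟨h, Or.inr h'⟩]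
  · rintro (h | ⟨h, h' | h'⟩)
    exacts [Or.inl (Or.inl h), Or.inl (Or.inr ⟨h, h'⟩), Or.inr (Or.inr ⟨h, h'⟩)]

lemma tailedGraph_hasDegreeBound (hB : B⁻¹ = B) (hfin : B.Finite) :
    HasDegreeBound (tailedGraph B T) (B.ncard + 2) := by
  intro v
  rw [← Subtype.val_injective.encard_image]
  have hsub : Subtype.val '' (tailedGraph B T).neighborSet v ⊆
      (fun s : W => (s • v.1.1, 0)) '' B ∪ {(v.1.1, v.1.2 + 1), (v.1.1, v.1.2 - 1)} := by
    rintro _ ⟨q, hq, rfl⟩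
    obtain ⟨-, ⟨-, h0, s, hs, h⟩ | ⟨h, h' | h'⟩⟩ := (tailedGraph_adj hB).1 hq
    · exact Or.inl ⟨s, hs, Prod.ext h.symm h0.symm⟩
    · exact Or.inr (Or.inl (Prod.ext h.symm h'))
    · exact Or.inr (Or.inr (Prod.ext h.symm (by simp [h'])))
  refine (Set.encard_le_encard hsub).trans ((Set.encard_union_le _ _).trans ?_)
  rw [Nat.cast_add, hfin.cast_ncard_eq]
  exact add_le_add (Set.encard_image_le _ _) 
    ((Set.encard_insert_le _ _).trans (by rw [Set.encard_singleton]; exact le_of_eq (by norm_num)))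

/-- Each edge either applies a generator or changes the height by one; tail steps are padded with
the identity. -/
lemma exists_smul_of_edist_le (hB : B⁻¹ = B) (h1 : 1 ∈ B) {p q : {p : X × ℕ // T p.1 p.2}} {r : ℕ}
    (h : (tailedGraph B T).edist p q ≤ r) :
    (∃ w ∈ B ^ r, q.1.1 = w • p.1.1) ∧ q.1.2 ≤ p.1.2 + r := by
  have hwalk : ∀ {p q : {p : X × ℕ // T p.1 p.2}} (c : (tailedGraph B T).Walk p q),
      (∃ w ∈ B ^ c.length, q.1.1 = w • p.1.1) ∧ q.1.2 ≤ p.1.2 + c.length := by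
    intro p q c
    induction c with
    | nil => exact ⟨⟨1, by simp⟩, by simp⟩
    | cons hadj c ih =>
      obtain ⟨⟨w, hw, h⟩, hle⟩ := ih
      rw [SimpleGraph.Walk.length_cons, pow_succ]
      obtain ⟨-, ⟨h0, h0', s, hs, h'⟩ | ⟨h', h0⟩⟩ := (tailedGraph_adj hB).1 hadj
      · exact ⟨⟨w * s, Set.mul_mem_mul hw hs, by rw [h, h', mul_smul]⟩, by omega⟩
      · exact ⟨⟨w * 1, Set.mul_mem_mul hw h1, by rw [h, h', mul_one]⟩, by omega⟩
  obtain ⟨c, hc⟩ := SimpleGraph.exists_walk_of_edist_ne_top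
    (ne_top_of_le_ne_top (ENat.natCast_ne_top r) h)
  rw [← hc, Nat.cast_le] at h
  obtain ⟨⟨w, hw, hwq⟩, hle⟩ := hwalk c
  exact ⟨⟨w, Set.pow_subset_pow_right h1 h hw, hwq⟩, by omega⟩

lemma edist_tail_le (hB : B⁻¹ = B) (hT : ∀ x, Antitone (T x)) (x : X) (i j : ℕ)
    (hj : T x (i + j)) :
    (tailedGraph B T).edist ⟨(x, i), hT x (Nat.le_add_right i j) hj⟩ ⟨(x, i + j), hj⟩ ≤ j := by
  induction j with
  | zero => simp
  | succ j ih =>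
    have hj' : T x (i + j) := hT x (by omega) hj
    refine ((tailedGraph B T).edist_triangle (v := ⟨(x, i + j), hj'⟩)).trans ?_
    rw [Nat.cast_add]
    refine add_le_add (ih hj') ?_
    rw [Nat.cast_one, SimpleGraph.edist_le_one_iff_adj_or_eq]
    left
    rw [tailedGraph_adj hB]
    refine ⟨?_, Or.inr ⟨rfl, Or.inl rfl⟩⟩
    simp [Subtype.ext_iff]

lemma edist_smul_le (hB : B⁻¹ = B) (hT0 : ∀ x, T x 0) (n : ℕ) :
    ∀ w ∈ B ^ n, ∀ x : X,
      (tailedGraph B T).edist ⟨(x, 0), hT0 x⟩ ⟨(w • x, 0), hT0 _⟩ ≤ n := by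
  induction n with
  | zero => simp
  | succ n ih =>
    intro w hw x
    rw [pow_succ] at hw
    obtain ⟨u, hu, s, hs, rfl⟩ := hw
    refine ((tailedGraph B T).edist_triangle (v := ⟨(s • x, 0), hT0 _⟩)).trans ?_
    rw [Nat.cast_add, add_comm]
    refine add_le_add ?_ ?_
    · simpa only [mul_smul] using ih u hu (s • x)
    · rw [Nat.cast_one, SimpleGraph.edist_le_one_iff_adj_or_eq, tailedGraph_adj hB]
      by_cases h : (⟨(x, 0), hT0 x⟩ : {p : X × ℕ // T p.1 p.2}) = ⟨(s • x, 0), hT0 _⟩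
      · exact Or.inr h
      · exact Or.inl ⟨h, Or.inl ⟨rfl, rfl, s, hs, rfl⟩⟩

/-- The part of the tail at `x` between the heights `i` and `i + n`. -/
def tailSegment (T : X → ℕ → Prop) (x : X) (i n : ℕ) : Set {p : X × ℕ // T p.1 p.2} :=
  {p | p.1.1 = x ∧ i ≤ p.1.2 ∧ p.1.2 ≤ i + n}

lemma image_tailSegment (hT : ∀ x, Antitone (T x)) {x : X} {i n : ℕ} (h : T x (i + n)) :
    Subtype.val '' tailSegment T x i n = (fun m => (x, m)) '' Set.Icc i (i + n) := by
  ext ⟨y, m⟩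
  constructor
  · rintro ⟨⟨⟨y', m'⟩, hp⟩, ⟨hx, h1, h2⟩, h3⟩
    obtain rfl : y' = x := hx
    obtain ⟨rfl, rfl⟩ := Prod.mk.inj h3
    exact ⟨m', ⟨h1, h2⟩, rfl⟩
  · rintro ⟨m', ⟨h1, h2⟩, h3⟩
    obtain ⟨rfl, rfl⟩ := Prod.mk.inj h3
    exact ⟨⟨(x, m'), hT x h2 h⟩, ⟨rfl, h1, h2⟩, rfl⟩

lemma tailSegment_isFolner (hB : B⁻¹ = B) (hT : ∀ x, Antitone (T x)) {x : X} {i n : ℕ}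
    (h : T x (i + n)) {ε : ℝ} (hε : 2 / ((n : ℝ) + 1) < ε) :
    IsFolner (tailedGraph B T) ε (tailSegment T x i n) := by
  have himg := image_tailSegment hT h
  have hinj : Function.Injective fun m : ℕ => (x, m) := fun a b hab => (Prod.mk.inj hab).2
  have hcard : (tailSegment T x i n).ncard = n + 1 := by
    rw [← Set.ncard_image_of_injective _ Subtype.val_injective, himg,
      Set.ncard_image_of_injective _ hinj, Set.ncard_eq_toFinset_card', Set.toFinset_Icc,
      Nat.card_Icc]
    omega
  have hbd : (boundary (tailedGraph B T) (tailSegment T x i n)).ncard ≤ 2 := by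
    rw [← Set.ncard_image_of_injective _ Subtype.val_injective]
    have hsub : Subtype.val '' boundary (tailedGraph B T) (tailSegment T x i n) ⊆
        {(x, i), (x, i + n)} := by
      rintro _ ⟨p, ⟨⟨hx, h1, h2⟩, q, hq, hadj⟩, rfl⟩
      obtain ⟨-, ⟨h0, -⟩ | ⟨h', h0⟩⟩ := (tailedGraph_adj hB).1 hadj
      -- A Schreier edge leaves from height 0, which forces `i = 0`, so `p` is the lower end.
      · exact Or.inl (Prod.ext hx (by simp; omega))
      · have hq' : ¬ (i ≤ q.1.2 ∧ q.1.2 ≤ i + n) := fun hh => hq ⟨h' ▸ hx, hh⟩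
        have : p.1.2 = i ∨ p.1.2 = i + n := by omega
        exact this.imp (fun hh => Prod.ext hx hh) (fun hh => Prod.ext hx hh)
    refine (Set.ncard_le_ncard hsub (Set.toFinite _)).trans ((Set.ncard_insert_le _ _).trans ?_)
    rw [Set.ncard_singleton]
  refine ⟨Set.finite_of_ncard_pos (by omega), Set.nonempty_of_ncard_ne_zero (by omega), ?_⟩
  refine lt_of_le_of_lt ?_ hε
  rw [hcard, Nat.cast_add, Nat.cast_one]
  gcongr
  exact_mod_cast hbd

lemma tailedGraph_uniformlyAmenable (hB : B⁻¹ = B) (hT : ∀ x, Antitone (T x)) (hT0 : ∀ x, T x 0)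
    (hdense : ∀ n, ∃ r, ∀ x, ∃ w ∈ B ^ r, T (w • x) n) :
    UniformlyAmenable (tailedGraph B T) := by
  intro ε hε
  obtain ⟨n, hn⟩ := exists_nat_gt (2 / ε)
  have hn' : 2 / ((n : ℝ) + 1) < ε := by
    rw [div_lt_iff₀ hε] at hn
    rw [div_lt_iff₀ (by positivity)]
    nlinarith
  obtain ⟨r, hr⟩ := hdense n
  -- From height at most `n`: descend to the base, move by `B ^ r` to a tall tail, climb at most
  -- `n`. From height at least `n`, the segment just below suffices.
  refine ⟨n + r + n, ?_⟩
  rintro ⟨⟨x, i⟩, hxi⟩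
  change T x i at hxi
  rcases le_total n i with hni | hni
  · obtain ⟨m, rfl⟩ := Nat.exists_eq_add_of_le' hni
    refine ⟨tailSegment T x m n, ?_, tailSegment_isFolner hB hT hxi hn'⟩
    rintro ⟨⟨y, j⟩, hyj⟩ ⟨hy, hmj, hj⟩
    obtain rfl : y = x := hy
    obtain ⟨l, hl⟩ : ∃ l, m + n = j + l := Nat.exists_eq_add_of_le hj
    have hd := edist_tail_le (B := B) hB hT y j l (hl ▸ hxi)
    rw [SimpleGraph.edist_comm] at hd
    simp only [closedBall, Set.mem_ofPred_eq, hl]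
    refine hd.trans ?_
    simp only at hmj
    exact_mod_cast (by omega : l ≤ n + r + n)
  · obtain ⟨w, hw, hwT⟩ := hr x
    refine ⟨tailSegment T (w • x) 0 n, ?_, tailSegment_isFolner hB hT (by simpa using hwT) hn'⟩
    rintro ⟨⟨y, j⟩, hyj⟩ ⟨hy, -, hj⟩
    obtain rfl : y = w • x := hy
    have d1 := edist_tail_le (B := B) hB hT x 0 i (by simpa using hxi)
    have d2 := edist_smul_le hB hT0 r w hw x
    have d3 := edist_tail_le (B := B) hB hT (w • x) 0 j (by simpa using hyj)
    rw [SimpleGraph.edist_comm] at d1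
    simp only [zero_add] at d1 d3 hj
    simp only [closedBall, Set.mem_ofPred_eq, Nat.cast_add]
    refine (SimpleGraph.edist_triangle (v := ⟨(w • x, 0), hT0 _⟩)).trans (add_le_add ?_ ?_)
    · refine (SimpleGraph.edist_triangle (v := ⟨(x, 0), hT0 _⟩)).trans (add_le_add ?_ d2)
      exact d1.trans (by exact_mod_cast hni)
    · exact d3.trans (by exact_mod_cast hj)

end TailedGraph

end FolnerGraph

/-! ### Counting argument against tilings. -/

namespace FolnerGraph

open scoped Pointwise

section Tilings

variable {W : Type*} [Group W] {X : Type*} [MulAction W X] {B : Set W} {T : X → ℕ → Prop}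

lemma finite_pow (hfin : B.Finite) (n : ℕ) : (B ^ n).Finite := by
  induction n with
  | zero => simp
  | succ n ih => rw [pow_succ]; exact ih.mul hfin

lemma ncard_base_le_two_mul_ncard_boundary (hB : B⁻¹ = B) (h1 : 1 ∈ B) (hfin : B.Finite)
    (hdouble : ∀ I F : Set W, F.Finite → (∀ w ∈ I, ∀ s ∈ B, s * w ∈ F) → 2 * I.ncard ≤ F.ncard)
    (hT0 : ∀ x, T x 0) {r : ℕ} {x₀ : X}
    (hinj : Set.InjOn (fun w : W => w • x₀) (B ^ (r + 1)))
    {F : Set {p : X × ℕ // T p.1 p.2}} (hF : F.Finite)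
    (hx₀ : (⟨(x₀, 0), hT0 x₀⟩ : {p : X × ℕ // T p.1 p.2}) ∈ F)
    (hdiam : DiamLE (tailedGraph B T) F r) :
    {p ∈ F | p.1.2 = 0}.ncard ≤ 2 * (boundary (tailedGraph B T) F).ncard := by
  set base : X → {p : X × ℕ // T p.1 p.2} := fun x => ⟨(x, 0), hT0 x⟩ with hbase
  have hbinj : Function.Injective base := fun a b hab => by
    simpa [hbase, Subtype.ext_iff] using hab
  set bd := boundary (tailedGraph B T) F with hbd
  have hbdF : bd ⊆ F := fun p hp => hp.1
  -- The exponent is `r + 1` because generators push the interior, which lies in the `r`-ball, one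
  -- step further.
  set F' : Set W := {w ∈ B ^ (r + 1) | base (w • x₀) ∈ F} with hF'
  set I' : Set W := {w ∈ B ^ r | base (w • x₀) ∈ F ∧ base (w • x₀) ∉ bd} with hI'
  have hF'fin : F'.Finite := (finite_pow hfin (r + 1)).subset fun w hw => hw.1
  have hI'fin : I'.Finite := (finite_pow hfin r).subset fun w hw => hw.1
  have hFb : {p ∈ F | p.1.2 = 0}.Finite := hF.subset fun p hp => hp.1
  have e1 : 2 * I'.ncard ≤ F'.ncard := by
    refine hdouble _ _ hF'fin ?_
    rintro w ⟨hw, hwF, hwb⟩ s hs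
    refine ⟨by rw [pow_succ']; exact Set.mul_mem_mul hs hw, ?_⟩
    by_contra hn
    refine hwb ⟨hwF, _, hn, (tailedGraph_adj hB).2 ⟨?_, Or.inl ⟨rfl, rfl, s, hs, ?_⟩⟩⟩
    · intro h
      exact hn (h ▸ hwF)
    · simp [hbase, mul_smul]
  have e2 : F'.ncard ≤ {p ∈ F | p.1.2 = 0}.ncard := by
    refine Set.ncard_le_ncard_of_injOn (fun w => base (w • x₀)) (fun w hw => ⟨hw.2, rfl⟩) ?_ hFb
    exact fun a ha b hb hab => hinj ha.1 hb.1 (hbinj hab)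
  have e3 : ({p ∈ F | p.1.2 = 0} \ bd).ncard ≤ I'.ncard := by
    refine (Set.ncard_le_ncard (t := (fun w => base (w • x₀)) '' I') ?_
      (hI'fin.image _)).trans (Set.ncard_image_le hI'fin)
    rintro p ⟨⟨hp, hp0⟩, hpb⟩
    obtain ⟨⟨w, hw, hwp⟩, -⟩ := exists_smul_of_edist_le hB h1 (hdiam _ hx₀ p hp)
    have : base (w • x₀) = p := Subtype.ext (Prod.ext hwp.symm hp0.symm)
    exact ⟨w, ⟨hw, by rwa [this], by rwa [this]⟩, this⟩
  have e4 := Set.ncard_le_ncard_sdiff_add_ncard {p ∈ F | p.1.2 = 0} bd (hF.subset hbdF)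
  omega

lemma tailedGraph_not_almostFinite (hB : B⁻¹ = B) (h1 : 1 ∈ B) (hfin : B.Finite)
    (hdouble : ∀ I F : Set W, F.Finite → (∀ w ∈ I, ∀ s ∈ B, s * w ∈ F) → 2 * I.ncard ≤ F.ncard)
    (hT0 : ∀ x, T x 0)
    (hpieces : ∀ r : ℕ, ∃ Y : Set X, Y.Finite ∧ Y.Nonempty ∧ (∀ w : W, ∀ y ∈ Y, w • y ∈ Y) ∧
      (∀ y ∈ Y, Set.InjOn (fun w : W => w • y) (B ^ (r + 1))) ∧
      {p : X × ℕ | p.1 ∈ Y ∧ p.2 ≤ r ∧ T p.1 p.2}.ncard ≤ 2 * Y.ncard) :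
    ¬ AlmostFinite (tailedGraph B T) := by
  classical
  intro haf
  -- With `1 / 4`, base part `≤ 2 * boundary` yields base part `<` half the tile, matching the
  -- factor 2 in `hpieces`.
  obtain ⟨r, -, P, hP, hcover⟩ := haf (1 / 4) (by norm_num)
  obtain ⟨Y, hYfin, ⟨y₀, hy₀⟩, hYinv, hYinj, hYcard⟩ := hpieces r
  have htile : ∀ p : {p : X × ℕ // T p.1 p.2}, ∃ F ∈ P, p ∈ F := fun p => by
    have : p ∈ ⋃₀ P := hcover ▸ Set.mem_univ p
    exact this
  choose t htP htmem using htile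
  have ht : ∀ F ∈ P, ∀ p ∈ F, t p = F := fun F hF p hp =>
    hP.disjoint.elim_set (htP p) hF p (htmem p) hp
  set base : X → {p : X × ℕ // T p.1 p.2} := fun x => ⟨(x, 0), hT0 x⟩ with hbase
  have hbinj : Function.Injective base := fun a b hab => by
    simpa [hbase, Subtype.ext_iff] using hab
  set C : Set {p : X × ℕ // T p.1 p.2} := {p | p.1.1 ∈ Y ∧ p.1.2 ≤ r} with hC
  have hCfin : C.Finite := by
    refine Set.Finite.of_finite_image (f := Subtype.val) ?_ Subtype.val_injective.injOn
    refine (hYfin.prod (Set.finite_Iic r)).subset ?_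
    rintro _ ⟨p, hp, rfl⟩
    exact hp
  have hCcard : C.ncard ≤ 2 * Y.ncard := by
    rw [← Set.ncard_image_of_injective _ Subtype.val_injective]
    refine le_trans (le_of_eq (congrArg Set.ncard ?_)) hYcard
    ext p
    constructor
    · rintro ⟨p, hp, rfl⟩
      exact ⟨hp.1, hp.2, p.2⟩
    · rintro ⟨h, h', h''⟩
      exact ⟨⟨p, h''⟩, ⟨h, h'⟩, rfl⟩
  have hsubC : ∀ y ∈ Y, t (base y) ⊆ C := by
    intro y hy p hp
    obtain ⟨⟨w, -, hw⟩, hle⟩ :=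
      exists_smul_of_edist_le hB h1 (hP.diam_le _ (htP _) _ (htmem (base y)) p hp)
    exact ⟨hw ▸ hYinv w y hy, by simpa [hbase] using hle⟩
  have hsmall : ∀ y ∈ Y, 2 * {p ∈ t (base y) | p.1.2 = 0}.ncard < (t (base y)).ncard := by
    intro y hy
    have hf := hP.folner _ (htP (base y))
    have h2 := ncard_base_le_two_mul_ncard_boundary hB h1 hfin hdouble hT0 (hYinj y hy) hf.finite
      (htmem (base y)) (hP.diam_le _ (htP (base y)))
    have hpos : (0 : ℝ) < (t (base y)).ncard := by
      exact_mod_cast (Set.ncard_pos hf.finite).2 hf.nonempty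
    have h3 := hf.ratio_lt
    rw [div_lt_iff₀ hpos] at h3
    have h4 : 4 * (boundary (tailedGraph B T) (t (base y))).ncard < (t (base y)).ncard := by
      have : (4 : ℝ) * (boundary (tailedGraph B T) (t (base y))).ncard < (t (base y)).ncard := by
        linarith
      exact_mod_cast this
    omega
  set Y' := hYfin.toFinset with hY'
  set C' := hCfin.toFinset with hC'
  set tiles := Y'.image fun y => t (base y) with htiles
  have hbaseSum : Y'.card = ∑ F ∈ tiles, {y ∈ Y' | t (base y) = F}.card :=
    Finset.card_eq_sum_card_fiberwise fun y hy => Finset.mem_image_of_mem _ hy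
  have htotal : ∑ F ∈ tiles, {p ∈ C' | t p = F}.card ≤ C'.card := by
    rw [Finset.sum_card_fiberwise_eq_card_filter]
    exact Finset.card_filter_le _ _
  have hstrict : ∑ F ∈ tiles, 2 * {y ∈ Y' | t (base y) = F}.card <
      ∑ F ∈ tiles, {p ∈ C' | t p = F}.card := by
    refine Finset.sum_lt_sum_of_nonempty ⟨_, Finset.mem_image_of_mem _ (hYfin.mem_toFinset.2 hy₀)⟩ ?_
    intro F hF
    obtain ⟨y, hy, rfl⟩ := Finset.mem_image.1 hF
    have hy := hYfin.mem_toFinset.1 hy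
    have hff := (hP.folner _ (htP (base y))).finite
    have c1 : {y' ∈ Y' | t (base y') = t (base y)}.card ≤
        {p ∈ t (base y) | p.1.2 = 0}.ncard := by
      rw [← Set.ncard_coe_finset]
      refine Set.ncard_le_ncard_of_injOn base ?_ hbinj.injOn (hff.subset fun p hp => hp.1)
      intro y' hy'
      have hy' := (Finset.mem_filter.1 (Finset.mem_coe.1 hy')).2
      exact ⟨hy' ▸ htmem (base y'), rfl⟩
    have c2 : (t (base y)).ncard ≤ {p ∈ C' | t p = t (base y)}.card := by
      rw [← Set.ncard_coe_finset]
      refine Set.ncard_le_ncard ?_ (Finset.finite_toSet _)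
      intro p hp
      simp only [Finset.coe_filter, Set.mem_ofPred_eq]
      exact ⟨hCfin.mem_toFinset.2 (hsubC y hy hp), ht _ (htP _) p hp⟩
    have := hsmall y hy
    omega
  rw [← Finset.mul_sum, ← hbaseSum] at hstrict
  have hCcard' : C'.card ≤ 2 * Y'.card := by
    rwa [Set.ncard_eq_toFinset_card _ hCfin, Set.ncard_eq_toFinset_card _ hYfin] at hCcard
  omega

end Tilings

end FolnerGraph

/-! ### Quotients by a tower of normal subgroups of finite index. -/

namespace FolnerGraph

open scoped Pointwise

section Tower

variable {W : Type*} [Group W] {B : Set W}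

lemma exists_mem_pow_of_closure (hB : B⁻¹ = B) (hgen : Subgroup.closure B = ⊤) (w : W) :
    ∃ n : ℕ, w ∈ B ^ n := by
  have hw : w ∈ Subgroup.closure B := hgen ▸ Subgroup.mem_top w
  induction hw using Subgroup.closure_induction with
  | mem x hx => exact ⟨1, by simpa using hx⟩
  | one => exact ⟨0, by simp⟩
  | mul x y _ _ hx hy =>
    obtain ⟨m, hm⟩ := hx
    obtain ⟨n, hn⟩ := hy
    exact ⟨m + n, by rw [pow_add]; exact Set.mul_mem_mul hm hn⟩
  | inv x _ hx =>
    obtain ⟨m, hm⟩ := hx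
    exact ⟨m, by rw [← hB, inv_pow]; exact Set.inv_mem_inv.2 hm⟩

lemma exists_pow_mul_mem (hB : B⁻¹ = B) (h1 : 1 ∈ B) (hgen : Subgroup.closure B = ⊤)
    (H : Subgroup W) [hH : H.Normal] [H.FiniteIndex] :
    ∃ r : ℕ, ∀ w : W, ∃ u ∈ B ^ r, u * w ∈ H := by
  have := Fintype.ofFinite (W ⧸ H)
  choose ℓ hℓ using exists_mem_pow_of_closure hB hgen
  refine ⟨Finset.univ.sup fun c : W ⧸ H => ℓ c.out, fun w => ⟨(w⁻¹ : W ⧸ H).out, ?_, ?_⟩⟩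
  · exact Set.pow_subset_pow_right h1
      (Finset.le_sup (f := fun c : W ⧸ H => ℓ c.out) (Finset.mem_univ _)) (hℓ _)
  · rw [← QuotientGroup.eq_one_iff, QuotientGroup.mk_mul, QuotientGroup.out_eq']
    simp

variable {N : ℕ → Subgroup W}

lemma exists_forall_mem_eq_one (hN : Antitone N) (htriv : ∀ g : W, g ≠ 1 → ∃ n, g ∉ N n)
    {D : Set W} (hD : D.Finite) (r : ℕ) : ∃ k, r ≤ k ∧ ∀ g ∈ D, g ∈ N k → g = 1 := by
  have h : ∀ g : W, ∃ n, g ∈ N n → g = 1 := fun g => by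
    by_cases hg : g = 1
    · exact ⟨0, fun _ => hg⟩
    · exact (htriv g hg).imp fun n hn hn' => absurd hn' hn
  choose f hf using h
  refine ⟨max r (hD.toFinset.sup f), le_max_left _ _, fun g hg hgk => hf g (hN ?_ hgk)⟩
  exact (Finset.le_sup (hD.mem_toFinset.2 hg)).trans (le_max_right _ _)

variable (N) [∀ k, (N k).Normal]

/-- The tail attached to a coset of `N k` reaches the height `n` if the coset meets `N n`. -/
def cosetTail (x : Σ k, W ⧸ N k) (n : ℕ) : Prop :=
  x.2 ∈ (N n).map (QuotientGroup.mk' (N x.1))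

variable {N}

lemma cosetTail_antitone (hN : Antitone N) (x : Σ k, W ⧸ N k) : Antitone (cosetTail N x) :=
  fun _ _ h hx => Subgroup.map_mono (hN h) hx

lemma cosetTail_zero (hN0 : N 0 = ⊤) (x : Σ k, W ⧸ N k) : cosetTail N x 0 := by
  obtain ⟨k, c⟩ := x
  obtain ⟨g, rfl⟩ := QuotientGroup.mk'_surjective _ c
  exact ⟨g, by simp [hN0], rfl⟩

/-- The radius comes from `W ⧸ N n` alone, hence serves all `k`. -/
lemma cosetTail_dense [∀ k, (N k).FiniteIndex] (hB : B⁻¹ = B) (h1 : 1 ∈ B)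
    (hgen : Subgroup.closure B = ⊤) (n : ℕ) :
    ∃ r, ∀ x : Σ k, W ⧸ N k, ∃ w ∈ B ^ r, cosetTail N (w • x) n := by
  obtain ⟨r, hr⟩ := exists_pow_mul_mem hB h1 hgen (N n)
  refine ⟨r, ?_⟩
  rintro ⟨k, c⟩
  obtain ⟨g, rfl⟩ := QuotientGroup.mk'_surjective _ c
  obtain ⟨u, hu, hug⟩ := hr g
  exact ⟨u, hu, u * g, hug, rfl⟩

/-- For `n ≤ k` the image of `N n` in `W ⧸ N k` keeps its index. Beyond `k` this fails: the trivial
coset has an infinite tail. -/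
lemma ncard_cosetTail_mul_two_pow_le (hN : Antitone N) [∀ k, (N k).FiniteIndex]
    (hindex : ∀ n, 2 ^ n ≤ (N n).index) {n k : ℕ} (hnk : n ≤ k) :
    {c : W ⧸ N k | cosetTail N ⟨k, c⟩ n}.ncard * 2 ^ n ≤ Nat.card (W ⧸ N k) := by
  have h1 := Subgroup.card_mul_index ((N n).map (QuotientGroup.mk' (N k)))
  rw [Subgroup.index_map_eq _ (QuotientGroup.mk'_surjective _)
    (by rw [QuotientGroup.ker_mk']; exact hN hnk)] at h1
  rw [← h1]
  exact Nat.mul_le_mul_left _ (hindex n)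

/-- Level `n` holds at most a fraction `2⁻ⁿ` of the cosets; the geometric series sums to at most 2.
-/
lemma ncard_truncated_component_le (hN : Antitone N) [∀ k, (N k).FiniteIndex]
    (hindex : ∀ n, 2 ^ n ≤ (N n).index) {r k : ℕ} (hrk : r ≤ k) :
    {p : (Σ k, W ⧸ N k) × ℕ |
      p.1 ∈ Set.range (Sigma.mk (β := fun k => W ⧸ N k) k) ∧ p.2 ≤ r ∧
        cosetTail N p.1 p.2}.ncard ≤ 2 * Nat.card (W ⧸ N k) := by
  have hsub : {p : (Σ k, W ⧸ N k) × ℕ |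
      p.1 ∈ Set.range (Sigma.mk (β := fun k => W ⧸ N k) k) ∧ p.2 ≤ r ∧ cosetTail N p.1 p.2} ⊆
      ⋃ n ∈ Finset.range (r + 1), (fun c : W ⧸ N k => ((⟨k, c⟩ : Σ k, W ⧸ N k), n)) ''
        {c : W ⧸ N k | cosetTail N ⟨k, c⟩ n} := by
    rintro ⟨_, n⟩ ⟨⟨c, rfl⟩, hn, hT⟩
    simp only [Set.mem_iUnion]
    exact ⟨n, Finset.mem_range.2 (Nat.lt_succ_of_le hn), c, hT, rfl⟩
  have hfin : (⋃ n ∈ Finset.range (r + 1), (fun c : W ⧸ N k => ((⟨k, c⟩ : Σ k, W ⧸ N k), n)) ''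
        {c : W ⧸ N k | cosetTail N ⟨k, c⟩ n}).Finite :=
    Set.Finite.biUnion (Finset.finite_toSet _) fun n _ => Set.toFinite _
  have h1 := (Set.ncard_le_ncard hsub hfin).trans (Finset.set_ncard_biUnion_le _ _)
  have h2 : ∀ n ∈ Finset.range (r + 1),
      (((fun c : W ⧸ N k => ((⟨k, c⟩ : Σ k, W ⧸ N k), n)) ''
        {c : W ⧸ N k | cosetTail N ⟨k, c⟩ n}).ncard : ℝ) ≤
        Nat.card (W ⧸ N k) * (1 / 2 : ℝ) ^ n := by
    intro n hn
    have hn : n ≤ k := by have := Finset.mem_range.1 hn; omega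
    have h3 := ncard_cosetTail_mul_two_pow_le hN hindex hn
    have h4 : ((fun c : W ⧸ N k => ((⟨k, c⟩ : Σ k, W ⧸ N k), n)) ''
        {c : W ⧸ N k | cosetTail N ⟨k, c⟩ n}).ncard * 2 ^ n ≤ Nat.card (W ⧸ N k) :=
      (Nat.mul_le_mul_right _ (Set.ncard_image_le (Set.toFinite _))).trans h3
    rw [one_div, inv_pow, ← div_eq_mul_inv, le_div_iff₀ (by positivity)]
    exact_mod_cast h4
  have h5 := Finset.sum_le_sum h2
  rw [← Finset.mul_sum] at h5
  have h6 := mul_le_mul_of_nonneg_left (sum_geometric_two_le (r + 1))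
    (Nat.cast_nonneg (α := ℝ) (Nat.card (W ⧸ N k)))
  have h7 := h5.trans h6
  rw [mul_comm]
  refine h1.trans ?_
  exact_mod_cast h7

theorem cosetGraph_uniformlyAmenable (hB : B⁻¹ = B) (h1 : 1 ∈ B)
    (hgen : Subgroup.closure B = ⊤) [∀ k, (N k).FiniteIndex] (hN : Antitone N) (hN0 : N 0 = ⊤) :
    UniformlyAmenable (tailedGraph B (cosetTail N)) :=
  tailedGraph_uniformlyAmenable hB (cosetTail_antitone hN) (cosetTail_zero hN0)
    (cosetTail_dense hB h1 hgen)

theorem cosetGraph_not_almostFinite (hB : B⁻¹ = B) (h1 : 1 ∈ B) (hfin : B.Finite)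
    (hdouble : ∀ I F : Set W, F.Finite → (∀ w ∈ I, ∀ s ∈ B, s * w ∈ F) → 2 * I.ncard ≤ F.ncard)
    [∀ k, (N k).FiniteIndex] (hN : Antitone N) (hN0 : N 0 = ⊤)
    (hindex : ∀ n, 2 ^ n ≤ (N n).index) (htriv : ∀ g : W, g ≠ 1 → ∃ n, g ∉ N n) :
    ¬ AlmostFinite (tailedGraph B (cosetTail N)) := by
  refine tailedGraph_not_almostFinite hB h1 hfin hdouble (cosetTail_zero hN0) fun r => ?_
  -- Avoiding the quotients `u⁻¹ * v` of elements of `B ^ (r + 1)` makes the orbit maps injective on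
  -- that ball.
  obtain ⟨k, hrk, hk⟩ := exists_forall_mem_eq_one hN htriv
    ((finite_pow hfin (r + 1)).inv.mul (finite_pow hfin (r + 1))) r
  refine ⟨Set.range (Sigma.mk k), Set.finite_range _, Set.range_nonempty _, ?_, ?_, ?_⟩
  · rintro w _ ⟨c, rfl⟩
    exact ⟨w • c, rfl⟩
  · rintro _ ⟨c, rfl⟩ u hu v hv huv
    obtain ⟨g, rfl⟩ := QuotientGroup.mk'_surjective _ c
    have huv' : ((u * g : W) : W ⧸ N k) = ((v * g : W) : W ⧸ N k) :=
      sigma_mk_injective (i := k) huv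
    rw [QuotientGroup.mk_mul, QuotientGroup.mk_mul, mul_left_inj, QuotientGroup.eq] at huv'
    exact inv_mul_eq_one.1 (hk _ (Set.mul_mem_mul (Set.inv_mem_inv.2 hu) hv) huv')
  · have hc : (Set.range (Sigma.mk (β := fun k => W ⧸ N k) k)).ncard = Nat.card (W ⧸ N k) := by
      rw [← Set.image_univ, Set.ncard_image_of_injective _ sigma_mk_injective, Set.ncard_univ]
    rw [hc]
    exact ncard_truncated_component_le hN hindex hrk

end Tower

end FolnerGraph

open CongruenceSubgroup in
theorem mainTheorem10 :
    ∃ (V : Type) (_ : Countable V) (G : SimpleGraph V) (d : ℕ),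
      FolnerGraph.HasDegreeBound G d ∧
        FolnerGraph.UniformlyAmenable G ∧ ¬ FolnerGraph.AlmostFinite G := by
  have hnormal : ∀ k : ℕ, (Gamma (3 ^ k)).Normal := fun k => Gamma_normal _
  have hcount : Countable (Matrix.SpecialLinearGroup (Fin 2) ℤ) := by
    have : Countable (Matrix (Fin 2) (Fin 2) ℤ) := inferInstanceAs (Countable (Fin 2 → Fin 2 → ℤ))
    exact Subtype.val_injective.countable
  have hquot : ∀ k : ℕ, Countable (Matrix.SpecialLinearGroup (Fin 2) ℤ ⧸ Gamma (3 ^ k)) :=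
    fun k => (QuotientGroup.mk_surjective).countable
  refine ⟨_, ?_,
    FolnerGraph.tailedGraph symmGenerators (FolnerGraph.cosetTail fun k => Gamma (3 ^ k)), _,
    FolnerGraph.tailedGraph_hasDegreeBound symmGenerators_inv symmGenerators_finite,
    FolnerGraph.cosetGraph_uniformlyAmenable symmGenerators_inv one_mem_symmGenerators
      closure_symmGenerators Gamma_three_pow_antitone Gamma_three_pow_zero,
    FolnerGraph.cosetGraph_not_almostFinite symmGenerators_inv one_mem_symmGenerators
      symmGenerators_finite (fun _ _ hF h => two_mul_ncard_le hF h) Gamma_three_pow_antitone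
      Gamma_three_pow_zero two_pow_le_index_Gamma fun _ hg => exists_notMem_Gamma hg⟩
  exact inferInstance
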